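/- Let $Y$ be a real Banach lattice that is strictly monotone, i.e. $\|x\|<\|y\|$ whenever $0\le x\le y$ in $Y$ and $x\neq y$, and let $L$ be a locally compact Hausdorff topological space with at least two points. Let $C_0(L)$ be the Banach lattice of continuous functions $L\to\mathbb{R}$ vanishing at infinity, with the sup norm and the pointwise order. A Banach lattice $Y$ is called uniformly monotone if for every $0<\varepsilon<1$ there is $0<\delta\le\varepsilon$ such that for all $x,y\ge 0$ in $Y$ with $\|x\|=1$ and $\|x+y\|\le 1+\delta$ one has $\|y\|\le\varepsilon$. A weak unit of $Y$ is an element $e\ge 0$ such that $x\ge 0$ and $e\wedge x=0$ imply $x=0$. For Banach lattices $X,Y$, the pair $(X,Y)$ has the Bishop–Phelps–Bollobás property for positive operators (BPBp for positive operators) if for every $0<\varepsilon<1$ there is $0<\eta(\varepsilon)<\varepsilon$ such that for every positive bounded linear operator $S:X\to Y$ with $\|S\|=1$ and every $x_0\in X$ with $\|x_0\|=1$ and $\|S(x_0)\|>1-\eta(\varepsilon)$, there exist $u_0\in X$ with $\|u_0\|=1$ and a positive bounded linear operator $T:X\to Y$ with $\|T\|=1$ such that $$\|T(u_0)\|=1,\qquad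 \|u_0-x_0\|<\varepsilon,\qquad \|T-S\|<\varepsilon .$$ Then the following hold. 1. If the pair $(C_0(L),Y)$ has the BPBp for positive operators, then $Y$ is uniformly monotone. 2. If $Y$ has a weak unit, the converse also holds: if $Y$ is uniformly monotone, then $(C_0(L),Y)$ has the BPBp for positive operators. -/

import Mathlib

open scoped ZeroAtInfty

/-! ### The Banach lattice `C₀(L, ℝ)` with the pointwise order -/

section ZeroAtInftyLattice

namespace ZeroAtInftyContinuousMap

variable {L : Type*} [TopologicalSpace L]

/-- The pointwise order on `C₀(L, ℝ)`. -/
instance instPartialOrderReal : PartialOrder C₀(L, ℝ) :=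
  PartialOrder.lift (fun f => (f : L → ℝ)) DFunLike.coe_injective

theorem le_iff_forall_real {f g : C₀(L, ℝ)} : f ≤ g ↔ ∀ t, f t ≤ g t := Iff.rfl

/-- The pointwise maximum of two functions vanishing at infinity. -/
noncomputable instance instMaxReal : Max C₀(L, ℝ) where
  max f g :=
    { toFun := fun t => f t ⊔ g t
      continuous_toFun := (map_continuous f).max (map_continuous g)
      zero_at_infty' := by
        simpa using (zero_at_infty f).max (zero_at_infty g) }

/-- The pointwise minimum of two functions vanishing at infinity. -/
noncomputable instance instMinReal : Min C₀(L, ℝ) where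
  min f g :=
    { toFun := fun t => f t ⊓ g t
      continuous_toFun := (map_continuous f).min (map_continuous g)
      zero_at_infty' := by
        simpa using (zero_at_infty f).min (zero_at_infty g) }

@[simp] theorem sup_apply_real (f g : C₀(L, ℝ)) (t : L) : (f ⊔ g) t = f t ⊔ g t := rfl

@[simp] theorem inf_apply_real (f g : C₀(L, ℝ)) (t : L) : (f ⊓ g) t = f t ⊓ g t := rfl

noncomputable instance instLatticeReal : Lattice C₀(L, ℝ) where
  sup := fun f g => f ⊔ g
  inf := fun f g => f ⊓ g
  le_sup_left f g t := le_sup_left (a := f t) (b := g t)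
  le_sup_right f g t := le_sup_right (a := f t) (b := g t)
  sup_le _ _ _ h₁ h₂ t := sup_le (h₁ t) (h₂ t)
  inf_le_left f g t := inf_le_left (a := f t) (b := g t)
  inf_le_right f g t := inf_le_right (a := f t) (b := g t)
  le_inf _ _ _ h₁ h₂ t := le_inf (h₁ t) (h₂ t)

theorem abs_apply_real (f : C₀(L, ℝ)) (t : L) : |f| t = |f t| := rfl

instance instIsOrderedAddMonoidReal : IsOrderedAddMonoid C₀(L, ℝ) where
  add_le_add_left f g h k t := by
    have := h t
    simpa using this

instance instIsOrderedModuleReal : IsOrderedModule ℝ C₀(L, ℝ) where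
  smul_le_smul_of_nonneg_left _ ha _ _ h t := mul_le_mul_of_nonneg_left (h t) ha
  smul_le_smul_of_nonneg_right _ hf _ _ h t := mul_le_mul_of_nonneg_right h (hf t)

instance instHasSolidNormReal : HasSolidNorm C₀(L, ℝ) where
  solid f g h := by
    rw [← norm_toBCF_eq_norm, ← norm_toBCF_eq_norm]
    refine (BoundedContinuousFunction.norm_le (norm_nonneg _)).2 fun t => ?_
    have h₁ : ‖f t‖ ≤ ‖g t‖ := h t
    exact h₁.trans (g.toBCF.norm_coe_le_norm t)

end ZeroAtInftyContinuousMap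

end ZeroAtInftyLattice

/-! ### Monotonicity properties of Banach lattices -/

section BanachLattice

variable (Y : Type*) [NormedAddCommGroup Y] [Lattice Y]

/-- Strict monotonicity of the norm on the positive cone. -/
def StrictlyMonotoneNorm : Prop :=
  ∀ x y : Y, 0 ≤ x → 0 ≤ y → x ≤ y → x ≠ y → ‖x‖ < ‖y‖

/-- Uniform monotonicity of the norm on the positive cone. -/
def UniformlyMonotoneNorm : Prop :=
  ∀ ε : ℝ, 0 < ε → ε < 1 → ∃ δ : ℝ, 0 < δ ∧ δ ≤ ε ∧
    ∀ x y : Y, 0 ≤ x → 0 ≤ y → ‖x‖ = 1 → ‖x + y‖ ≤ 1 + δ → ‖y‖ ≤ ε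

/-- The existence of a weak unit: a positive element `e` such that only `0` is disjoint
from `e`. -/
def HasWeakUnit : Prop :=
  ∃ e : Y, 0 ≤ e ∧ ∀ x : Y, 0 ≤ x → e ⊓ x = 0 → x = 0

end BanachLattice

/-! ### The Bishop-Phelps-Bollobás property for positive operators -/

section BPB

variable {X Y : Type*}
  [NormedAddCommGroup X] [NormedSpace ℝ X] [Lattice X]
  [NormedAddCommGroup Y] [NormedSpace ℝ Y] [Lattice Y]

/-- A bounded operator is positive if it maps the positive cone into the positive cone. -/
def IsPositiveOperator (S : X →L[ℝ] Y) : Prop :=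
  ∀ x : X, 0 ≤ x → 0 ≤ S x

variable (X Y) in
/-- The pair `(X, Y)` has the Bishop-Phelps-Bollobás property for positive operators. -/
def HasBPBpPositive : Prop :=
  ∀ ε : ℝ, 0 < ε → ε < 1 → ∃ η : ℝ, 0 < η ∧ η < ε ∧
    ∀ S : X →L[ℝ] Y, ‖S‖ = 1 → IsPositiveOperator S →
      ∀ x₀ : X, ‖x₀‖ = 1 → 1 - η < ‖S x₀‖ →
        ∃ (u₀ : X) (T : X →L[ℝ] Y), ‖u₀‖ = 1 ∧ ‖T‖ = 1 ∧ IsPositiveOperator T ∧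
          ‖T u₀‖ = 1 ∧ ‖u₀ - x₀‖ < ε ∧ ‖T - S‖ < ε

end BPB

/-! Necessity: take bumps `f`, `g` with disjoint supports around points `t₁ ≠ t₂`. The operator `k ↦
‖x + y‖⁻¹ • (k t₁ • x + k t₂ • y)` has norm one and almost attains it at `f` when `‖x‖ = 1` and `‖x
+ y‖` is close to 1. A nearby `T` attains its norm at some `u` near `f`. A fixed multiple of `g` can
be added to `|u|` inside the unit ball, so strict monotonicity forces `T g = 0`; hence `S g`, which
is `y` up to scaling, is small.

Sufficiency: uniform monotonicity makes `S` small on bounded functions living where `|x|` stays away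
from 1, and makes `S x⁺ ⊓ S x⁻` small. It also makes increasing norm-bounded positive sequences
converge, which yields band projections `P`. With cutoffs `p`, `m` to the regions where `x` is near
1 and near -1, the operator `T f = P S (p f) + (1 - P) S (m f)` is close to `S`. A function `u` near
`x`, equal to 1 where `p ≠ 0` and to -1 where `m ≠ 0`, satisfies `|T u| = P S p + (1 - P) S m`,
which dominates `|T f|` for every `f` in the unit ball. So `T` attains its norm at `u`, and
rescaling finishes. -/

open Filter Topology

/-! ### Lattice identities and disjointness -/

section LatticeOrderedGroup

variable {Y : Type*} [AddCommGroup Y] [Lattice Y] [IsOrderedAddMonoid Y]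

theorem inf_add_le_inf_add_inf {c y z : Y} (hc : 0 ≤ c) (hy : 0 ≤ y) (hz : 0 ≤ z) :
    c ⊓ (y + z) ≤ c ⊓ y + c ⊓ z := by
  rw [inf_add, add_inf, add_inf]
  refine le_inf (le_inf ?_ ?_) (le_inf ?_ inf_le_right)
  · exact inf_le_left.trans (le_add_of_nonneg_left hc)
  · exact inf_le_left.trans (le_add_of_nonneg_right hz)
  · exact inf_le_left.trans (le_add_of_nonneg_left hy)

theorem nsmul_inf_eq_zero_of_inf_eq_zero {c d : Y} (hc : 0 ≤ c) (hd : 0 ≤ d) (h : c ⊓ d = 0)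
    (n : ℕ) : (n • c) ⊓ d = 0 := by
  induction n with
  | zero => simpa using hd
  | succ n ih =>
    refine le_antisymm ?_ (le_inf (nsmul_nonneg hc _) hd)
    rw [succ_nsmul, inf_comm]
    refine (inf_add_le_inf_add_inf hd (nsmul_nonneg hc n) hc).trans ?_
    rw [inf_comm d, inf_comm d, ih, h, add_zero]

theorem abs_sub_eq_add_of_inf_eq_zero {a b : Y} (h : a ⊓ b = 0) : |a - b| = a + b := by
  have := two_nsmul_inf_eq_add_sub_abs_sub a b
  rw [h, nsmul_zero, abs_sub_comm] at this
  exact (sub_eq_zero.1 this.symm).symm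

end LatticeOrderedGroup

section NormedLattice

variable {Y : Type*} [NormedAddCommGroup Y] [Lattice Y] [IsOrderedAddMonoid Y] [HasSolidNorm Y]

theorem norm_le_norm_of_nonneg_of_le {x y : Y} (hx : 0 ≤ x) (hxy : x ≤ y) : ‖x‖ ≤ ‖y‖ :=
  norm_le_norm_of_abs_le_abs (by rwa [abs_of_nonneg hx, abs_of_nonneg (hx.trans hxy)])

theorem norm_le_norm_of_abs_le {x y : Y} (hxy : |x| ≤ y) : ‖x‖ ≤ ‖y‖ := by
  rw [← norm_abs_eq_norm x]
  exact norm_le_norm_of_nonneg_of_le (abs_nonneg x) hxy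

end NormedLattice

/-! ### Uniform monotonicity and band projections -/

section UniformlyMonotone

variable {Y : Type*} [NormedAddCommGroup Y] [NormedSpace ℝ Y] [Lattice Y]
  [IsOrderedModule ℝ Y]

theorem UniformlyMonotoneNorm.exists_norm_le_mul (hU : UniformlyMonotoneNorm Y) {ε : ℝ}
    (hε : 0 < ε) (hε1 : ε < 1) : ∃ δ : ℝ, 0 < δ ∧ δ ≤ ε ∧ ∀ x y : Y, 0 ≤ x → 0 ≤ y →
      ‖x + y‖ ≤ (1 + δ) * ‖x‖ → ‖y‖ ≤ ε * ‖x‖ := by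
  obtain ⟨δ, hδ, hδε, H⟩ := hU ε hε hε1
  refine ⟨δ, hδ, hδε, fun x y hx hy hxy => ?_⟩
  rcases eq_or_ne x 0 with rfl | hx0
  · simpa using hxy
  have hn : 0 < ‖x‖ := norm_pos_iff.2 hx0
  have hn' : 0 ≤ ‖x‖⁻¹ := by positivity
  have := H (‖x‖⁻¹ • x) (‖x‖⁻¹ • y) (smul_nonneg hn' hx) (smul_nonneg hn' hy)
    (by rw [norm_smul, norm_inv, norm_norm, inv_mul_cancel₀ hn.ne'])
    (by
      rw [← smul_add, norm_smul, norm_inv, norm_norm, inv_mul_le_iff₀ hn]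
      linarith)
  rw [norm_smul, norm_inv, norm_norm, inv_mul_le_iff₀ hn] at this
  linarith

variable [IsOrderedAddMonoid Y] [HasSolidNorm Y]

theorem UniformlyMonotoneNorm.exists_norm_le (hU : UniformlyMonotoneNorm Y) {ε : ℝ}
    (hε : 0 < ε) (hε1 : ε < 1) : ∃ η : ℝ, 0 < η ∧ η < ε ∧ ∀ x y : Y, 0 ≤ x → 0 ≤ y →
      1 - η < ‖x‖ → ‖x + y‖ ≤ 1 → ‖y‖ ≤ ε := by
  obtain ⟨δ, hδ, hδε, H⟩ := hU.exists_norm_le_mul hε hε1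
  refine ⟨δ / 2, by linarith, by linarith, fun x y hx hy h1 h2 => ?_⟩
  have h3 : ‖x‖ ≤ 1 := (norm_le_norm_of_nonneg_of_le hx (le_add_of_nonneg_right hy)).trans h2
  have := H x y hx hy (h2.trans (by nlinarith))
  nlinarith

/-- The norms increase to a supremum `l`. Once `‖u N‖` is close enough to `l`, uniform monotonicity
applied to `u N` and `u n - u N` bounds the increment. -/
theorem UniformlyMonotoneNorm.cauchySeq (hU : UniformlyMonotoneNorm Y) {u : ℕ → Y}
    (hu : Monotone u) (h0 : ∀ n, 0 ≤ u n) {C : ℝ} (hC : ∀ n, ‖u n‖ ≤ C) : CauchySeq u := by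
  have hm : Monotone fun n => ‖u n‖ := fun m n h => norm_le_norm_of_nonneg_of_le (h0 m) (hu h)
  have hbdd : BddAbove (Set.range fun n => ‖u n‖) := ⟨C, by rintro _ ⟨n, rfl⟩; exact hC n⟩
  have hlim := tendsto_atTop_ciSup hm hbdd
  set l := ⨆ n, ‖u n‖
  have hle : ∀ n, ‖u n‖ ≤ l := fun n => le_ciSup hbdd n
  have hl0 : 0 ≤ l := (norm_nonneg _).trans (hle 0)
  rw [Metric.cauchySeq_iff']
  intro ε hε
  rcases hl0.eq_or_lt with hl | hl
  · refine ⟨0, fun n _ => ?_⟩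
    have hz : ∀ n, u n = 0 := fun n => norm_le_zero_iff.1 ((hle n).trans hl.ge)
    simpa [hz] using hε
  -- The second bound gives `e * ‖u N‖ ≤ ε / 2`; the first keeps `e < 1`.
  set e := min (1 / 2) (ε / (2 * l))
  have he : 0 < e := by positivity
  obtain ⟨δ, hδ, -, H⟩ := hU.exists_norm_le_mul he ((min_le_left _ _).trans_lt (by norm_num))
  obtain ⟨N, hN⟩ := (hlim.eventually (lt_mem_nhds
    (show l / (1 + δ) < l by rw [div_lt_iff₀ (by linarith)]; nlinarith))).exists
  refine ⟨N, fun n hn => ?_⟩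
  rw [div_lt_iff₀ (by linarith)] at hN
  have h1 := H (u N) (u n - u N) (h0 N) (sub_nonneg.2 (hu hn)) (by
    rw [add_sub_cancel]
    linarith [hle n])
  have h2 : e * l ≤ ε / 2 := by
    refine (mul_le_mul_of_nonneg_right (min_le_right _ _) hl0).trans_eq ?_
    field_simp
  rw [dist_eq_norm]
  nlinarith [hle N]

/-- In a uniformly monotone Banach lattice, every principal band is the range of a band
projection. -/
theorem UniformlyMonotoneNorm.exists_bandProjection [CompleteSpace Y]
    (hU : UniformlyMonotoneNorm Y) {c : Y} (hc : 0 ≤ c) :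
    ∃ P : Y →L[ℝ] Y, (∀ y, 0 ≤ y → 0 ≤ P y ∧ P y ≤ y) ∧ (∀ y, P (P y) = P y) ∧ P c = c ∧
      ∀ d, 0 ≤ d → c ⊓ d = 0 → P d = 0 := by
  have hmono : Monotone fun n : ℕ => n • c := fun m n h => nsmul_le_nsmul_left hc h
  have hex : ∀ y : Y, ∃ l, 0 ≤ y → Tendsto (fun n : ℕ => (n • c) ⊓ y) atTop (𝓝 l) := by
    intro y
    by_cases hy : 0 ≤ y
    · have h0 : ∀ n : ℕ, 0 ≤ (n • c) ⊓ y := fun n => le_inf (nsmul_nonneg hc n) hy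
      obtain ⟨l, hl⟩ := cauchySeq_tendsto_of_complete
        (hU.cauchySeq (u := fun n : ℕ => (n • c) ⊓ y)
          (fun m n h => inf_le_inf_right y (hmono h)) h0
          (fun n => norm_le_norm_of_nonneg_of_le (h0 n) inf_le_right))
      exact ⟨l, fun _ => hl⟩
    · exact ⟨0, fun h => absurd h hy⟩
  choose p hp using hex
  have p_nonneg : ∀ y, 0 ≤ y → 0 ≤ p y := fun y hy =>
    ge_of_tendsto' (hp y hy) fun n => le_inf (nsmul_nonneg hc n) hy
  have p_le : ∀ y, 0 ≤ y → p y ≤ y := fun y hy =>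
    le_of_tendsto' (hp y hy) fun n => inf_le_right
  have p_add : ∀ y z, 0 ≤ y → 0 ≤ z → p (y + z) = p y + p z := by
    intro y z hy hz
    have h1 := hp _ (add_nonneg hy hz)
    have h2 := (hp y hy).add (hp z hz)
    refine le_antisymm (le_of_tendsto_of_tendsto' h1 h2 fun n =>
      inf_add_le_inf_add_inf (nsmul_nonneg hc n) hy hz) ?_
    -- Superadditivity holds along even indices: `n • c ⊓ y + n • c ⊓ z ≤ (2 * n) • c ⊓ (y + z)`.
    have h3 := h1.comp (tendsto_id.const_mul_atTop' (two_pos : (0 : ℕ) < 2))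
    refine le_of_tendsto_of_tendsto' h2 h3 fun n => ?_
    simp only [Function.comp, id]
    rw [two_mul, add_nsmul]
    exact le_inf (add_le_add inf_le_left inf_le_left) (add_le_add inf_le_right inf_le_right)
  -- The value `p a - p b` depends only on `a - b`, so `p` extends additively from the cone.
  have p_sub : ∀ a b, 0 ≤ a → 0 ≤ b → p (a - b)⁺ - p (a - b)⁻ = p a - p b := by
    intro a b ha hb
    rw [sub_eq_sub_iff_add_eq_add, ← p_add _ _ (posPart_nonneg _) hb,
      ← p_add _ _ ha (negPart_nonneg _)]
    congr 1
    rw [← sub_eq_sub_iff_add_eq_add, posPart_sub_negPart]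
  let F : Y →+ Y := AddMonoidHom.mk' (fun y => p y⁺ - p y⁻) (by
    intro a b
    have := p_sub (a⁺ + b⁺) (a⁻ + b⁻) (add_nonneg (posPart_nonneg _) (posPart_nonneg _))
      (add_nonneg (negPart_nonneg _) (negPart_nonneg _))
    rw [add_sub_add_comm, posPart_sub_negPart, posPart_sub_negPart,
      p_add _ _ (posPart_nonneg _) (posPart_nonneg _),
      p_add _ _ (negPart_nonneg _) (negPart_nonneg _), add_sub_add_comm] at this
    exact this)
  have hF : ∀ y, F y = p y⁺ - p y⁻ := fun _ => rfl
  have hFc : Continuous F := by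
    refine AddMonoidHomClass.continuous_of_bound F 1 fun y => ?_
    rw [one_mul]
    refine norm_le_norm_of_abs_le_abs (abs_le'.2 ⟨?_, ?_⟩)
    · rw [hF, ← posPart_add_negPart y]
      exact (sub_le_self _ (p_nonneg _ (negPart_nonneg _))).trans
        ((p_le _ (posPart_nonneg _)).trans (le_add_of_nonneg_right (negPart_nonneg _)))
    · rw [hF, neg_sub, ← posPart_add_negPart y]
      exact (sub_le_self _ (p_nonneg _ (posPart_nonneg _))).trans
        ((p_le _ (negPart_nonneg _)).trans (le_add_of_nonneg_left (posPart_nonneg _)))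
  have hF0 : ∀ y, 0 ≤ y → Tendsto (fun n : ℕ => (n • c) ⊓ y) atTop (𝓝 (F y)) := by
    intro y hy
    have h0 : Tendsto (fun n : ℕ => (n • c) ⊓ (0 : Y)) atTop (𝓝 0) := by
      refine tendsto_const_nhds.congr fun n => ?_
      exact (inf_eq_right.2 (nsmul_nonneg hc n)).symm
    rw [hF, posPart_of_nonneg hy, negPart_of_nonneg hy,
      tendsto_nhds_unique (hp 0 le_rfl) h0, sub_zero]
    exact hp y hy
  have hfix : ∀ y : Y, 0 ≤ y → ∀ n : ℕ, y ≤ n • c → F y = y := by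
    intro y hy n hn
    refine tendsto_nhds_unique (hF0 y hy) (tendsto_const_nhds.congr' ?_)
    filter_upwards [eventually_ge_atTop n] with m hm
    exact (inf_eq_right.2 (hn.trans (hmono hm))).symm
  -- The truncations `n • c ⊓ y` are fixed by `F`; continuity passes this to the limit.
  have hidem : ∀ y, 0 ≤ y → F (F y) = F y := by
    intro y hy
    refine tendsto_nhds_unique ((hFc.tendsto _).comp (hF0 y hy)) ((hF0 y hy).congr fun n => ?_)
    exact (hfix _ (le_inf (nsmul_nonneg hc n) hy) n inf_le_left).symm
  refine ⟨F.toRealLinearMap hFc, ?_, ?_, ?_, ?_⟩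
  · intro y hy
    exact ⟨ge_of_tendsto' (hF0 y hy) fun n => le_inf (nsmul_nonneg hc n) hy,
      le_of_tendsto' (hF0 y hy) fun n => inf_le_right⟩
  · intro y
    change F (F y) = F y
    rw [← posPart_sub_negPart y, map_sub, map_sub, hidem _ (posPart_nonneg _),
      hidem _ (negPart_nonneg _)]
  · exact hfix c hc 1 (by simp)
  · intro d hd h
    refine tendsto_nhds_unique (hF0 d hd) (tendsto_const_nhds.congr fun n => ?_)
    exact (nsmul_inf_eq_zero_of_inf_eq_zero hc hd h n).symm

end UniformlyMonotone

section BandProjection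

variable {Y : Type*} [NormedAddCommGroup Y] [NormedSpace ℝ Y] [CompleteSpace Y] [Lattice Y]
  [IsOrderedAddMonoid Y] [IsOrderedModule ℝ Y] [HasSolidNorm Y]

/-- The band projection onto the band generated by `(a - b)⁺` separates `a` from `b` up to
`a ⊓ b`. -/
theorem UniformlyMonotoneNorm.exists_projection_separating (hU : UniformlyMonotoneNorm Y)
    {a b : Y} (ha : 0 ≤ a) (hb : 0 ≤ b) :
    ∃ P : Y →L[ℝ] Y, (∀ y, 0 ≤ y → 0 ≤ P y ∧ P y ≤ y) ∧
      (∀ y z, 0 ≤ y → 0 ≤ z → P y ⊓ (z - P z) = 0) ∧ P b ≤ a ⊓ b ∧ a - P a ≤ a ⊓ b := by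
  obtain ⟨P, hP, hPP, hPc, hPd⟩ := hU.exists_bandProjection (posPart_nonneg (a - b))
  have hm : ∀ {y z}, y ≤ z → P y ≤ P z := fun {y z} h => by
    have := (hP (z - y) (sub_nonneg.2 h)).1
    rwa [map_sub, sub_nonneg] at this
  have hd := hPd _ (negPart_nonneg (a - b)) (posPart_inf_negPart_eq_zero _)
  have hab : P a - P b = (a - b)⁺ := by
    rw [← map_sub]
    conv_lhs => rw [← posPart_sub_negPart (a - b)]
    rw [map_sub, hPc, hd, sub_zero]
  refine ⟨P, hP, ?_, le_inf ?_ (hP b hb).2, le_inf (sub_le_self _ (hP a ha).1) ?_⟩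
  · intro y z hy hz
    have hy' := hP y hy
    have hz' := hP z hz
    -- An element below both a value of `P` and a value of `1 - P` is killed by `1 - P` and by `P`.
    set w := P y ⊓ (z - P z)
    have hw : 0 ≤ w := le_inf hy'.1 (sub_nonneg.2 hz'.2)
    have h1 : P w ≤ 0 := (hm (inf_le_right : w ≤ _)).trans (by rw [map_sub, hPP, sub_self])
    have h2 : w - P w ≤ 0 := by
      have h3 : w ≤ P y := inf_le_left
      have h4 := (hP (P y - w) (sub_nonneg.2 h3)).2
      rw [map_sub, hPP] at h4
      rw [sub_nonpos]
      exact (sub_le_sub_iff_left _).1 h4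
    exact le_antisymm ((sub_nonpos.1 h2).trans h1) hw
  · exact (sub_nonneg.1 (hab ▸ posPart_nonneg _)).trans (hP a ha).2
  · have h5 : a - P a ≤ b - P b := by
      have h6 : (b - P b) - (a - P a) = (a - b)⁻ := by
        rw [← sub_eq_zero, ← sub_eq_zero.2 (posPart_sub_negPart (a - b)), ← hab]
        abel
      rw [← sub_nonneg, h6]
      exact negPart_nonneg _
    exact h5.trans (sub_le_self _ (hP b hb).1)

end BandProjection

theorem abs_smul_le_smul {Y : Type*} [AddCommGroup Y] [Module ℝ Y] [Lattice Y]
    [IsOrderedAddMonoid Y] [IsOrderedModule ℝ Y] {c : ℝ} {x : Y} (hx : 0 ≤ x) :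
    |c • x| ≤ |c| • x :=
  abs_le'.2 ⟨smul_le_smul_of_nonneg_right (le_abs_self c) hx, by
    rw [← neg_smul]
    exact smul_le_smul_of_nonneg_right (neg_le_abs c) hx⟩

/-! ### Positive operators -/

section PositiveOperator

variable {X Y : Type*} [NormedAddCommGroup X] [NormedSpace ℝ X] [Lattice X]
  [NormedAddCommGroup Y] [NormedSpace ℝ Y] [Lattice Y] [IsOrderedAddMonoid X] [IsOrderedAddMonoid Y]

theorem IsPositiveOperator.monotone {T : X →L[ℝ] Y} (hT : IsPositiveOperator T) : Monotone T :=
  fun x y h => by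
    have := hT (y - x) (sub_nonneg.2 h)
    rwa [map_sub, sub_nonneg] at this

theorem IsPositiveOperator.abs_apply_le {T : X →L[ℝ] Y} (hT : IsPositiveOperator T) (x : X) :
    |T x| ≤ T |x| :=
  abs_le'.2 ⟨hT.monotone (le_abs_self x), by
    rw [← map_neg]
    exact hT.monotone (neg_le_abs x)⟩

variable [HasSolidNorm Y]

theorem IsPositiveOperator.norm_apply_le {T : X →L[ℝ] Y} (hT : IsPositiveOperator T) {x y : X}
    (h : |x| ≤ y) : ‖T x‖ ≤ ‖T y‖ :=
  norm_le_norm_of_abs_le ((hT.abs_apply_le x).trans (hT.monotone h))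

end PositiveOperator

/-! ### Functions vanishing at infinity -/

namespace ZeroAtInftyContinuousMap

variable {L : Type*} [TopologicalSpace L]

theorem abs_apply_le_norm (f : C₀(L, ℝ)) (t : L) : |f t| ≤ ‖f‖ :=
  f.toBCF.norm_coe_le_norm t

theorem norm_le_of_abs_apply_le {f : C₀(L, ℝ)} {C : ℝ} (hC : 0 ≤ C) (h : ∀ t, |f t| ≤ C) :
    ‖f‖ ≤ C :=
  (BoundedContinuousFunction.norm_le hC).2 h

/-- Postcomposition with a continuous real function vanishing at `0`. -/
def postcomp (h : ℝ → ℝ) (hc : Continuous h) (h0 : h 0 = 0) (f : C₀(L, ℝ)) : C₀(L, ℝ) where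
  toFun t := h (f t)
  continuous_toFun := hc.comp (map_continuous f)
  zero_at_infty' := by
    have := (hc.tendsto 0).comp (zero_at_infty f)
    rwa [h0] at this

/-- Evaluation at a point as a bounded linear functional. -/
noncomputable def evalCLM (t : L) : C₀(L, ℝ) →L[ℝ] ℝ :=
  LinearMap.mkContinuous
    { toFun := fun f => f t
      map_add' := fun _ _ => rfl
      map_smul' := fun _ _ => rfl } 1 fun f => by
        rw [one_mul]
        exact abs_apply_le_norm f t

theorem exists_bump [LocallyCompactSpace L] [T2Space L] {t : L} {U : Set L} (hU : IsOpen U)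
    (ht : t ∈ U) :
    ∃ f : C₀(L, ℝ), f t = 1 ∧ (∀ s, 0 ≤ f s) ∧ (∀ s, f s ≤ 1) ∧ ∀ s, s ∉ U → f s = 0 := by
  obtain ⟨f, h1, h0, hf, h01⟩ := exists_continuous_one_zero_of_isCompact
    (isCompact_singleton (x := t)) hU.isClosed_compl
    (Set.disjoint_compl_right_iff_subset.2 (Set.singleton_subset_iff.2 ht))
  refine ⟨⟨f, ?_⟩, h1 rfl, fun s => (h01 s).1, fun s => (h01 s).2, fun s hs => h0 hs⟩
  exact hf.is_zero_at_infty

theorem abs_mul_apply_le {φ f : C₀(L, ℝ)} (hφ : 0 ≤ φ) (hf : ‖f‖ ≤ 1) : |φ * f| ≤ φ := by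
  refine le_iff_forall_real.2 fun t => ?_
  rw [abs_apply_real, mul_apply, abs_mul, abs_of_nonneg (hφ t)]
  exact mul_le_of_le_one_right (hφ t) ((abs_apply_le_norm f t).trans hf)

end ZeroAtInftyContinuousMap

/-! ### Necessity of uniform monotonicity -/

open ZeroAtInftyContinuousMap

theorem uniformlyMonotoneNorm_of_hasBPBpPositive
    {L : Type*} [TopologicalSpace L] [LocallyCompactSpace L] [T2Space L] [Nontrivial L]
    {Y : Type*} [NormedAddCommGroup Y] [NormedSpace ℝ Y]
    [Lattice Y] [IsOrderedAddMonoid Y] [IsOrderedModule ℝ Y] [HasSolidNorm Y]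
    (hY : StrictlyMonotoneNorm Y) (hB : HasBPBpPositive C₀(L, ℝ) Y) :
    UniformlyMonotoneNorm Y := by
  intro ε hε hε1
  obtain ⟨η, hη, hηε, H⟩ := hB (ε / 2) (by linarith) (by linarith)
  refine ⟨η, hη, by linarith, fun x y hx hy hx1 hxy => ?_⟩
  obtain ⟨t₁, t₂, ht⟩ := exists_pair_ne L
  obtain ⟨U, V, hU, hV, htU, htV, hUV⟩ := t2_separation ht
  obtain ⟨f, hf1, hf0, hfle, hfU⟩ := exists_bump hU htU
  obtain ⟨g, hg1, hg0, hgle, hgV⟩ := exists_bump hV htV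
  have hdisj : ∀ s, f s = 0 ∨ g s = 0 := fun s => by
    by_cases hs : s ∈ U
    · exact Or.inr (hgV s (Set.disjoint_left.1 hUV hs))
    · exact Or.inl (hfU s hs)
  have hft₂ : f t₂ = 0 := (hdisj t₂).resolve_right (by simp [hg1])
  have hgt₁ : g t₁ = 0 := (hdisj t₁).resolve_left (by simp [hf1])
  have hfg : ‖f + g‖ ≤ 1 := norm_le_of_abs_apply_le zero_le_one fun s => by
    rw [ZeroAtInftyContinuousMap.add_apply, abs_of_nonneg (add_nonneg (hf0 s) (hg0 s))]
    rcases hdisj s with h | h <;> simp [h, hfle s, hgle s]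
  have hN : 1 ≤ ‖x + y‖ := hx1 ▸ norm_le_norm_of_nonneg_of_le hx (le_add_of_nonneg_right hy)
  have hN0 : 0 < ‖x + y‖ := by linarith
  let S : C₀(L, ℝ) →L[ℝ] Y :=
    ‖x + y‖⁻¹ • ((evalCLM t₁).smulRight x + (evalCLM t₂).smulRight y)
  have hS : ∀ k, S k = ‖x + y‖⁻¹ • (k t₁ • x + k t₂ • y) := fun k => rfl
  have hSpos : IsPositiveOperator S := fun k hk => by
    rw [hS]
    exact smul_nonneg (by positivity)
      (add_nonneg (smul_nonneg (hk t₁) hx) (smul_nonneg (hk t₂) hy))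
  have hSfg : ‖S (f + g)‖ = 1 := by
    rw [hS, ZeroAtInftyContinuousMap.add_apply, ZeroAtInftyContinuousMap.add_apply, hf1, hg1,
      hft₂, hgt₁, add_zero, zero_add, one_smul, one_smul, norm_smul, norm_inv, norm_norm,
      inv_mul_cancel₀ hN0.ne']
  have hSle : ‖S‖ ≤ 1 := by
    refine ContinuousLinearMap.opNorm_le_bound _ zero_le_one fun k => ?_
    rw [hS, norm_smul, norm_inv, norm_norm, inv_mul_le_iff₀ hN0, one_mul]
    have : |k t₁ • x + k t₂ • y| ≤ ‖k‖ • (x + y) := by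
      rw [smul_add]
      refine (abs_add_le _ _).trans (add_le_add ?_ ?_)
      · exact (abs_smul_le_smul hx).trans
          (smul_le_smul_of_nonneg_right (abs_apply_le_norm k t₁) hx)
      · exact (abs_smul_le_smul hy).trans
          (smul_le_smul_of_nonneg_right (abs_apply_le_norm k t₂) hy)
    refine (norm_le_norm_of_abs_le this).trans_eq ?_
    rw [norm_smul, norm_norm, mul_comm]
  have hS1 : ‖S‖ = 1 := by
    refine le_antisymm hSle ?_
    have := S.le_opNorm_of_le hfg
    rwa [hSfg, mul_one] at this
  have hfn : ‖f‖ = 1 := by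
    refine le_antisymm (norm_le_of_abs_apply_le zero_le_one fun s => ?_) ?_
    · rw [abs_of_nonneg (hf0 s)]
      exact hfle s
    · simpa [hf1] using abs_apply_le_norm f t₁
  obtain ⟨u, T, hu, hT, hTpos, hTu, huf, hTS⟩ := H S hS1 hSpos f hfn (by
    rw [hS, hf1, hft₂]
    simp only [one_smul, zero_smul, add_zero, norm_smul, norm_inv, norm_norm, hx1, mul_one]
    rw [lt_inv_comm₀ (by linarith) hN0]
    refine hxy.trans_lt ?_
    rw [← one_div, lt_div_iff₀ (by linarith)]
    nlinarith)
  have hTg : T g = 0 := by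
    -- Where `g ≠ 0` one has `f = 0`, hence `|u| ≤ ε / 2`, which leaves room for `(1 - ε / 2) • g`.
    have hle : ‖|u| + (1 - ε / 2) • g‖ ≤ 1 := norm_le_of_abs_apply_le zero_le_one fun s => by
      rw [ZeroAtInftyContinuousMap.add_apply, ZeroAtInftyContinuousMap.smul_apply,
        abs_apply_real, smul_eq_mul,
        abs_of_nonneg (add_nonneg (abs_nonneg _) (mul_nonneg (by linarith) (hg0 s)))]
      rcases hdisj s with h | h
      · have := (abs_apply_le_norm (u - f) s).trans huf.le
        rw [ZeroAtInftyContinuousMap.sub_apply, h, sub_zero] at this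
        nlinarith [hgle s, hg0 s]
      · have := abs_apply_le_norm u s
        rw [h]
        linarith
    by_contra hne
    have hg : 0 ≤ T g := hTpos g hg0
    have hsm : 0 ≤ T ((1 - ε / 2) • g) := by
      rw [map_smul]
      exact smul_nonneg (by linarith) hg
    have h1 := hY (T |u|) (T (|u| + (1 - ε / 2) • g)) (hTpos _ (abs_nonneg u))
      (by rw [map_add]; exact add_nonneg (hTpos _ (abs_nonneg u)) hsm)
      (by rw [map_add]; exact le_add_of_nonneg_right hsm)
      (by
        rw [map_add, map_smul, Ne, left_eq_add, smul_eq_zero]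
        rintro (h | h)
        · linarith
        · exact hne h)
    have h2 := hTpos.norm_apply_le (le_refl |u|)
    have h3 := T.le_opNorm_of_le hle
    rw [hT] at h3
    linarith
  have h1 : ‖(T - S) g‖ ≤ ε / 2 := by
    have := (T - S).le_of_opNorm_le_of_le hTS.le (norm_le_of_abs_apply_le zero_le_one fun s => by
      rw [abs_of_nonneg (hg0 s)]
      exact hgle s)
    rwa [mul_one] at this
  rw [_root_.sub_apply, hTg, hS, hg1, hgt₁] at h1
  simp only [one_smul, zero_smul, zero_add, zero_sub, norm_neg, norm_smul, norm_inv, norm_norm]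
    at h1
  rw [inv_mul_le_iff₀ hN0] at h1
  nlinarith

/-! ### Scalar cutoffs and normalization -/

theorem exists_continuous_cutoff {r : ℝ} (hr : 0 < r) (hr1 : r ≤ 1 / 4) :
    ∃ h : ℝ → ℝ, Continuous h ∧ (∀ s, 0 ≤ h s) ∧ (∀ s, h s ≤ 1) ∧ (∀ s ≤ 1 - 2 * r, h s = 0) ∧
      (∀ s, 1 - r ≤ s → h s = 1) ∧ ∀ s, h s ≤ 2 * (s ⊔ 0) := by
  have h0 : ∀ s ≤ 1 - 2 * r, max 0 (min 1 ((s - (1 - 2 * r)) / r)) = 0 := fun s hs =>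
    max_eq_left ((min_le_right _ _).trans (div_nonpos_of_nonpos_of_nonneg (by linarith) hr.le))
  have h1 : ∀ s, max 0 (min 1 ((s - (1 - 2 * r)) / r)) ≤ 1 := fun s =>
    max_le zero_le_one (min_le_left _ _)
  refine ⟨fun s => max 0 (min 1 ((s - (1 - 2 * r)) / r)), by fun_prop, fun s => le_max_left _ _,
    h1, h0, fun s hs => ?_, fun s => ?_⟩
  · have : 1 ≤ (s - (1 - 2 * r)) / r := by
      rw [le_div_iff₀ hr]
      linarith
    simp [min_eq_left this]
  -- Beyond `1 - 2 * r ≥ 1 / 2` one has `2 * s ≥ 1`. This bound later compares `p` with `2 • x⁺`.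
  · rcases le_total s (1 - 2 * r) with hs | hs
    · exact (h0 s hs).le.trans (by positivity)
    · exact (h1 s).trans (by linarith [le_max_left s 0])

theorem exists_continuous_sign_approx {r : ℝ} (hr : 0 < r) (hr1 : r ≤ 1 / 4) :
    ∃ k : ℝ → ℝ, Continuous k ∧ k 0 = 0 ∧ (∀ s, |k s| ≤ 1) ∧ (∀ s, 1 - 2 * r ≤ s → k s = 1) ∧
      (∀ s, s ≤ -(1 - 2 * r) → k s = -1) ∧ ∀ s, |s| ≤ 1 → |k s - s| ≤ 2 * r := by
  have hc : 0 < 1 - 2 * r := by linarith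
  have h1 : ∀ s, 1 - 2 * r ≤ s → max (-1) (min 1 (s / (1 - 2 * r))) = 1 := fun s hs => by
    rw [min_eq_left ((one_le_div hc).2 hs)]
    norm_num
  have h2 : ∀ s, s ≤ -(1 - 2 * r) → max (-1) (min 1 (s / (1 - 2 * r))) = -1 := fun s hs => by
    refine max_eq_left ((min_le_right _ _).trans ?_)
    rw [div_le_iff₀ hc]
    linarith
  refine ⟨fun s => max (-1) (min 1 (s / (1 - 2 * r))), by fun_prop, by simp,
    fun s => abs_le.2 ⟨le_max_left _ _, max_le (by norm_num) (min_le_left _ _)⟩, h1, h2,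
    fun s hs => ?_⟩
  rw [abs_le] at hs
  rcases le_total (1 - 2 * r) s with h | h
  · simp only [h1 s h]
    exact abs_le.2 ⟨by linarith, by linarith⟩
  rcases le_total s (-(1 - 2 * r)) with h' | h'
  · simp only [h2 s h']
    exact abs_le.2 ⟨by linarith, by linarith⟩
  have h3 : s / (1 - 2 * r) ≤ 1 := (div_le_one hc).2 h
  have h4 : -1 ≤ s / (1 - 2 * r) := by
    rw [le_div_iff₀ hc]
    linarith
  simp only [min_eq_right h3, max_eq_right h4]
  have h5 : s / (1 - 2 * r) - s = s / (1 - 2 * r) * (2 * r) := by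
    field_simp
    ring
  rw [h5, abs_mul, abs_of_pos (show 0 < 2 * r by linarith)]
  exact mul_le_of_le_one_left (by linarith) (abs_le.2 ⟨h4, h3⟩)

section Normalization

variable {X Y : Type*} [NormedAddCommGroup X] [NormedSpace ℝ X]
  [NormedAddCommGroup Y] [NormedSpace ℝ Y]

theorem norm_pos_of_norm_sub_lt_one {S T : X →L[ℝ] Y} (hS : ‖S‖ = 1) (hT : ‖T - S‖ < 1) :
    0 < ‖T‖ := by
  have := norm_sub_norm_le S T
  rw [hS, norm_sub_rev] at this
  linarith

theorem norm_inv_norm_smul_eq_one {T : X →L[ℝ] Y} (hT : 0 < ‖T‖) : ‖‖T‖⁻¹ • T‖ = 1 := by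
  rw [norm_smul, norm_inv, norm_norm, inv_mul_cancel₀ hT.ne']

theorem norm_inv_norm_smul_apply_eq_one {T : X →L[ℝ] Y} (hT : 0 < ‖T‖) {x : X}
    (hx : ‖T x‖ = ‖T‖) : ‖(‖T‖⁻¹ • T) x‖ = 1 := by
  rw [_root_.smul_apply, norm_smul, norm_inv, norm_norm, hx, inv_mul_cancel₀ hT.ne']

/-- Rescaling moves `T` by `|‖T‖ - ‖S‖| ≤ ‖T - S‖`, whence the factor 2. -/
theorem norm_inv_norm_smul_sub_le {S T : X →L[ℝ] Y} (hS : ‖S‖ = 1) (h0 : 0 < ‖T‖) :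
    ‖‖T‖⁻¹ • T - S‖ ≤ 2 * ‖T - S‖ := by
  have h1 : ‖‖T‖⁻¹ • T - T‖ ≤ ‖T - S‖ := by
    have h2 : ‖T‖⁻¹ • T - T = (‖T‖⁻¹ - 1) • T := by rw [sub_smul, one_smul]
    rw [h2, norm_smul, Real.norm_eq_abs, ← abs_of_pos h0, ← abs_mul, abs_of_pos h0, sub_mul,
      inv_mul_cancel₀ h0.ne', one_mul, abs_sub_comm, ← hS]
    exact abs_norm_sub_norm_le T S
  calc ‖‖T‖⁻¹ • T - S‖ = ‖(‖T‖⁻¹ • T - T) + (T - S)‖ := by rw [sub_add_sub_cancel]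
    _ ≤ ‖‖T‖⁻¹ • T - T‖ + ‖T - S‖ := norm_add_le _ _
    _ ≤ 2 * ‖T - S‖ := by linarith

end Normalization

/-- When `‖S x‖` is almost 1, uniform monotonicity applied to this sum makes the overlap term small.
-/
theorem abs_apply_add_two_nsmul_inf {X Y : Type*} [NormedAddCommGroup X] [NormedSpace ℝ X]
    [Lattice X] [IsOrderedAddMonoid X] [NormedAddCommGroup Y] [NormedSpace ℝ Y] [Lattice Y]
    [IsOrderedAddMonoid Y] (S : X →L[ℝ] Y) (x : X) :
    |S x| + 2 • (S x⁺ ⊓ S x⁻) = S |x| := by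
  rw [two_nsmul_inf_eq_add_sub_abs_sub, abs_sub_comm, ← map_sub, ← map_add,
    posPart_sub_negPart, posPart_add_negPart]
  abel

theorem le_two_nsmul_inf {Y : Type*} [AddCommGroup Y] [Module ℝ Y] [Lattice Y]
    [IsOrderedAddMonoid Y] [IsOrderedModule ℝ Y] {x y z : Y} (hx : z ≤ 2 • x) (hy : z ≤ 2 • y) :
    z ≤ 2 • (x ⊓ y) := by
  have h : ∀ w : Y, z ≤ 2 • w → (2⁻¹ : ℝ) • z ≤ w := fun w hw => by
    have := smul_le_smul_of_nonneg_left hw (by norm_num : (0 : ℝ) ≤ 2⁻¹)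
    rwa [← Nat.cast_smul_eq_nsmul ℝ, smul_smul, Nat.cast_ofNat, inv_mul_cancel₀ two_ne_zero,
      one_smul] at this
  have := smul_le_smul_of_nonneg_left (le_inf (h x hx) (h y hy)) (by norm_num : (0 : ℝ) ≤ 2)
  rwa [smul_smul, mul_inv_cancel₀ two_ne_zero, one_smul, ← Nat.cast_ofNat,
    Nat.cast_smul_eq_nsmul] at this

/-! ### Sufficiency of uniform monotonicity -/

theorem hasBPBpPositive_of_uniformlyMonotoneNorm
    {L : Type*} [TopologicalSpace L]
    {Y : Type*} [NormedAddCommGroup Y] [NormedSpace ℝ Y] [CompleteSpace Y]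
    [Lattice Y] [IsOrderedAddMonoid Y] [IsOrderedModule ℝ Y] [HasSolidNorm Y]
    (hU : UniformlyMonotoneNorm Y) : HasBPBpPositive C₀(L, ℝ) Y := by
  intro ε hε hε1
  set r := ε / 8 with hr_def
  have hr : 0 < r := by positivity
  have hr1 : r ≤ 1 / 4 := by linarith
  obtain ⟨h, hcont, hh0, hh1, hhz, hho, hh2⟩ := exists_continuous_cutoff hr hr1
  obtain ⟨k, kcont, k0, k1, kpos, kneg, kapp⟩ := exists_continuous_sign_approx hr hr1
  have he1 : ε * r / 6 < ε := by nlinarith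
  -- The factor `r` is lost when `H` is applied to `S (r • |g|)`. The three errors then sum to at
  -- most `ε / 6 + 2 * (ε * r / 6) ≤ ε / 4`, as `r ≤ 1 / 4`.
  obtain ⟨η, hη, hηe, H⟩ := hU.exists_norm_le (ε := ε * r / 6) (by positivity) (he1.trans hε1)
  refine ⟨η, hη, hηe.trans he1, fun S hS hSpos x hx hSx => ?_⟩
  have hx1 : ∀ t, |x t| ≤ 1 := fun t => hx ▸ abs_apply_le_norm x t
  have hSabs : ‖S |x|‖ ≤ 1 := by
    have := S.le_opNorm |x|
    rwa [hS, norm_abs_eq_norm, hx, one_mul] at this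
  set p : C₀(L, ℝ) := postcomp h hcont (hhz 0 (by linarith)) x
  set m : C₀(L, ℝ) := postcomp h hcont (hhz 0 (by linarith)) (-x)
  set u : C₀(L, ℝ) := postcomp k kcont k0 x
  have hpt : ∀ t, p t = h (x t) := fun t => rfl
  have hmt : ∀ t, m t = h (-x t) := fun t => rfl
  have hut : ∀ t, u t = k (x t) := fun t => rfl
  have hp0 : 0 ≤ p := le_iff_forall_real.2 fun t => hh0 _
  have hm0 : 0 ≤ m := le_iff_forall_real.2 fun t => hh0 _
  have hpu : p * u = p := ZeroAtInftyContinuousMap.ext fun t => by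
    rw [mul_apply, hpt, hut]
    rcases le_total (x t) (1 - 2 * r) with hs | hs
    · rw [hhz _ hs, zero_mul]
    · rw [kpos _ hs, mul_one]
  have hmu : m * u = -m := ZeroAtInftyContinuousMap.ext fun t => by
    rw [mul_apply, ZeroAtInftyContinuousMap.neg_apply, hmt, hut]
    rcases le_total (-x t) (1 - 2 * r) with hs | hs
    · rw [hhz _ hs, zero_mul, neg_zero]
    · rw [kneg (x t) (by linarith), mul_neg_one]
  have hu1 : ‖u‖ ≤ 1 := norm_le_of_abs_apply_le zero_le_one fun t => k1 _
  have hux : ‖u - x‖ < ε := by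
    refine (norm_le_of_abs_apply_le (by linarith : 0 ≤ 2 * r) fun t => ?_).trans_lt (by linarith)
    exact kapp _ (hx1 t)
  set a := S p
  set b := S m
  obtain ⟨P, hP, hPd, hPb, hPa⟩ := hU.exists_projection_separating (hSpos p hp0) (hSpos m hm0)
  -- `a ⊓ b` is small, since `S x⁺` and `S x⁻` are almost disjoint
  have hab : ‖a ⊓ b‖ ≤ ε * r / 6 := by
    have hap : a ≤ 2 • S x⁺ := by
      rw [← map_nsmul]
      refine hSpos.monotone (le_iff_forall_real.2 fun t => ?_)
      exact (hh2 (x t)).trans_eq (nsmul_eq_mul 2 _).symm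
    have hbm : b ≤ 2 • S x⁻ := by
      rw [← map_nsmul]
      refine hSpos.monotone (le_iff_forall_real.2 fun t => ?_)
      exact (hh2 (-x t)).trans_eq (nsmul_eq_mul 2 _).symm
    have hxp := hSpos _ (posPart_nonneg x)
    have hxm := hSpos _ (negPart_nonneg x)
    refine (norm_le_norm_of_nonneg_of_le (le_inf (hSpos p hp0) (hSpos m hm0))
      (le_two_nsmul_inf (inf_le_left.trans hap) (inf_le_right.trans hbm))).trans ?_
    refine H |S x| _ (abs_nonneg _) (nsmul_nonneg (le_inf hxp hxm) 2) ?_ ?_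
    · rwa [norm_abs_eq_norm]
    · rwa [abs_apply_add_two_nsmul_inf]
  -- `S` is small where `|x|` is not close to `1`
  have hrest : ∀ f : C₀(L, ℝ), ‖f‖ ≤ 1 → ‖S (f - p * f - m * f)‖ ≤ ε / 6 := by
    intro f hf
    set g := f - p * f - m * f with hg
    -- The factor `1 - h (x t) - h (-x t)` vanishes where `|x t| ≥ 1 - r` and lies in `[0, 1]`
    -- elsewhere.
    have hxg : ‖|x| + r • |g|‖ ≤ 1 := norm_le_of_abs_apply_le zero_le_one fun t => by
      have hft : |f t| ≤ 1 := (abs_apply_le_norm f t).trans hf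
      have hgt : g t = (1 - h (x t) - h (-x t)) * f t := by
        rw [hg, ZeroAtInftyContinuousMap.sub_apply, ZeroAtInftyContinuousMap.sub_apply,
          mul_apply, mul_apply, hpt, hmt]
        ring
      have hval : (|x| + r • |g|) t = |x t| + r * |g t| := rfl
      rw [hval, abs_of_nonneg (by positivity), hgt, abs_mul]
      have key : ∀ s, 0 ≤ s → s ≤ 1 → s + r * (|1 - h s - h (-s)| * |f t|) ≤ 1 := by
        intro s hs0 hs1
        rw [hhz (-s) (by linarith), sub_zero, abs_of_nonneg (by linarith [hh1 s])]
        rcases le_total (1 - r) s with hs | hs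
        · rw [hho s hs]
          linarith
        · have : (1 - h s) * |f t| ≤ 1 :=
            mul_le_one₀ (by linarith [hh0 s]) (abs_nonneg _) hft
          nlinarith
      rcases le_total 0 (x t) with hs | hs
      · rw [abs_of_nonneg hs]
        exact key _ hs ((le_abs_self _).trans (hx1 t))
      · have := key (-x t) (by linarith) ((neg_le_abs _).trans (hx1 t))
        rw [neg_neg, sub_right_comm] at this
        rwa [abs_of_nonpos hs]
    have hSg := H (S |x|) (S (r • |g|)) (hSpos _ (abs_nonneg x))
      (hSpos _ (smul_nonneg hr.le (abs_nonneg g)))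
      (hSx.trans_le (hSpos.norm_apply_le le_rfl))
      (by
        rw [← map_add]
        have := S.le_opNorm_of_le hxg
        rwa [hS, one_mul] at this)
    rw [map_smul, norm_smul, Real.norm_of_nonneg hr.le] at hSg
    have := hSpos.norm_apply_le (le_refl |g|)
    refine this.trans (le_of_mul_le_mul_left ?_ hr)
    linarith
  set A : C₀(L, ℝ) →L[ℝ] Y := P ∘L S
  set B : C₀(L, ℝ) →L[ℝ] Y := S - P ∘L S
  have hA : IsPositiveOperator A := fun f hf => (hP _ (hSpos f hf)).1
  have hB : IsPositiveOperator B := fun f hf => sub_nonneg.2 (hP _ (hSpos f hf)).2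
  have hAB : ∀ f, S f = A f + B f := fun f => (add_sub_cancel (P (S f)) (S f)).symm
  set T : C₀(L, ℝ) →L[ℝ] Y :=
    A ∘L ContinuousLinearMap.mul ℝ C₀(L, ℝ) p + B ∘L ContinuousLinearMap.mul ℝ C₀(L, ℝ) m
  have hT : ∀ f, T f = A (p * f) + B (m * f) := fun f => rfl
  have hTpos : IsPositiveOperator T := fun f hf => by
    rw [hT]
    exact add_nonneg (hA _ (le_iff_forall_real.2 fun t => mul_nonneg (hp0 t) (hf t)))
      (hB _ (le_iff_forall_real.2 fun t => mul_nonneg (hm0 t) (hf t)))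
  have hTu : ‖T u‖ = ‖A p + B m‖ := by
    have : |T u| = A p + B m := by
      rw [hT, hpu, hmu, map_neg, ← sub_eq_add_neg]
      exact abs_sub_eq_add_of_inf_eq_zero (hPd a b (hSpos p hp0) (hSpos m hm0))
    rw [← norm_abs_eq_norm, this]
  have hTn : ‖T‖ = ‖T u‖ := by
    refine le_antisymm (T.opNorm_le_of_unit_norm (norm_nonneg _) fun f hf => ?_) ?_
    · rw [hTu]
      refine norm_le_norm_of_abs_le ?_
      rw [hT]
      refine (abs_add_le _ _).trans (add_le_add ?_ ?_)
      · exact (hA.abs_apply_le _).trans (hA.monotone (abs_mul_apply_le hp0 hf.le))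
      · exact (hB.abs_apply_le _).trans (hB.monotone (abs_mul_apply_le hm0 hf.le))
    · simpa using T.le_opNorm_of_le hu1
  have hTS : ‖T - S‖ ≤ ε / 4 := by
    refine ContinuousLinearMap.opNorm_le_of_unit_norm (by positivity) fun f hf => ?_
    -- The cross terms `B (p * f)` and `A (m * f)` are controlled by `a ⊓ b`, through `a - P a ≤ a ⊓
    -- b` and `P b ≤ a ⊓ b`.
    have h1 : (T - S) f = -(S (f - p * f - m * f) + B (p * f) + A (m * f)) := by
      rw [_root_.sub_apply, hT, map_sub, map_sub, hAB (p * f), hAB (m * f)]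
      abel
    have h2 : ‖B (p * f)‖ ≤ ε * r / 6 :=
      (hB.norm_apply_le (abs_mul_apply_le hp0 hf.le)).trans
        ((norm_le_norm_of_nonneg_of_le (hB p hp0) hPa).trans hab)
    have h3 : ‖A (m * f)‖ ≤ ε * r / 6 :=
      (hA.norm_apply_le (abs_mul_apply_le hm0 hf.le)).trans
        ((norm_le_norm_of_nonneg_of_le (hA m hm0) hPb).trans hab)
    rw [h1, norm_neg]
    refine (norm_add₃_le ..).trans ?_
    have := hrest f hf.le
    nlinarith
  have hT0 : 0 < ‖T‖ := norm_pos_of_norm_sub_lt_one hS (hTS.trans_lt (by linarith))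
  have hTn1 : ‖‖T‖⁻¹ • T‖ = 1 := norm_inv_norm_smul_eq_one hT0
  have hTu1 : ‖(‖T‖⁻¹ • T) u‖ = 1 := norm_inv_norm_smul_apply_eq_one hT0 hTn.symm
  refine ⟨u, ‖T‖⁻¹ • T, le_antisymm hu1 ?_, hTn1, fun f hf => ?_, hTu1, hux, ?_⟩
  · have := (‖T‖⁻¹ • T).le_opNorm u
    rwa [hTn1, hTu1, one_mul] at this
  · exact smul_nonneg (by positivity) (hTpos f hf)
  · exact (norm_inv_norm_smul_sub_le hS hT0).trans_lt (by linarith)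

theorem mainTheorem5
    {L : Type*} [TopologicalSpace L] [LocallyCompactSpace L] [T2Space L] [Nontrivial L]
    {Y : Type*} [NormedAddCommGroup Y] [NormedSpace ℝ Y] [CompleteSpace Y]
    [Lattice Y] [IsOrderedAddMonoid Y] [IsOrderedModule ℝ Y] [HasSolidNorm Y]
    (hY : StrictlyMonotoneNorm Y) :
    (HasBPBpPositive C₀(L, ℝ) Y → UniformlyMonotoneNorm Y) ∧
      (HasWeakUnit Y → UniformlyMonotoneNorm Y → HasBPBpPositive C₀(L, ℝ) Y) :=
  ⟨uniformlyMonotoneNorm_of_hasBPBpPositive hY,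
    fun _ hU => hasBPBpPositive_of_uniformlyMonotoneNorm hU⟩
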